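/- All rings are associative with identity and all modules are unitary. For a ring $A$ and left $A$-modules, $\mathrm{add}_A T$ is the class of modules isomorphic to a direct summand of a finite direct sum of copies of $T$, and $\mathrm{gen}^*(T)$ is the class of modules $N$ admitting an exact sequence $$\cdots\xrightarrow{f_2} T_1\xrightarrow{f_1} T_0\xrightarrow{f_0} N\to 0$$ with all $T_i\in\mathrm{add}_A T$ and $\mathrm{Ext}^1_A(T,\mathrm{Ker} f_i)=0$ for all $i\ge 0$; similarly for right modules. A right $R$-module $T_R$ is *Wakamatsu tilting* if (i) $T_R\in\mathrm{gen}^*(R)$; (ii) $\mathrm{Ext}^i_R(T,T)=0$ for all $i>0$; (iii) there is an exact sequence $0\to R\to T_0\to T_1\to T_2\to\cdots$ with all $T_i\in\mathrm{add}_R T$ which stays exact after applying $\mathrm{Hom}_R(-,T)$. For $n\in\mathbb N$, $T_R$ is *$n$-tilting* (in the sense of Miyashita) if (i) $T_R\in\mathrm{gen}^*(R)$ and $\mathrm{pd}(T_R)\le n$; (ii) $\mathrm{Ext}^i_R(T,T)=0$ for all $i>0$; (iii) there is an exact sequence $0\to R\to T_0\to\cdots\to T_n\to 0$ with all $T_i\in\mathrm{add}_R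 T$. It is *tilting* if it is $n$-tilting for some $n$. An $(S,R)$-bimodule ${}_ST_R$ is *Wakamatsu tilting* if $T_R$ is Wakamatsu tilting and the canonical ring homomorphism $S\to\mathrm{End}(T_R)$ is an isomorphism. The *generalized Auslander–Reiten conjecture (GARC) holds for a ring $A$* if, for every finitely generated left $A$-module $M$ and every integer $n\ge 0$, the vanishing $\mathrm{Ext}^i_A(M,M\oplus A)=0$ for all $i>n$ implies $\mathrm{pd}({}_AM)\le n$. The *Wakamatsu tilting conjecture (WTC) holds for a ring $R$* if every Wakamatsu tilting right $R$-module of finite projective dimension is tilting. **Theorem 1.3.** (a) Let $S$ and $R$ be rings and let ${}_ST_R$ be a Wakamatsu tilting bimodule with $\mathrm{pd}(T_R)<\infty$. If the GARC holds for $S$, then $T_R$ is a tilting module. (b) Consequently, if the GARC holds for all rings, then the WTC holds for all rings. -/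

import Mathlib

open CategoryTheory CategoryTheory.Abelian

universe u

/-!
All notions are defined for left modules over a ring `A`. A right `R`-module `T_R` is a left module
over the opposite ring `Rᵐᵒᵖ`, and the regular right module `R_R` is `Rᵐᵒᵖ` as a left module over
itself.
-/

namespace WakamatsuTilting

section

variable (A : Type u) [Ring A]

/-- `Ext^i_A(M, N) = 0`. -/
def ExtVanishes (M N : Type u) [AddCommGroup M] [Module A M] [AddCommGroup N] [Module A N]
    (i : ℕ) : Prop :=
  Subsingleton (Ext (ModuleCat.of A M) (ModuleCat.of A N) i)

/-- The projective dimension of the `A`-module `M`, with value `⊤` if it is infinite (and `⊥` for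
the zero module). -/
noncomputable def pd (M : Type u) [AddCommGroup M] [Module A M] : WithBot ℕ∞ :=
  projectiveDimension (ModuleCat.of A M)

/-- `N` belongs to `add T`: it is isomorphic to a direct summand of a direct sum `T^k` of finitely
many copies of `T`, that is, there are maps `N → T^k → N` with composite the identity. -/
def IsInAdd (T N : Type u) [AddCommGroup T] [Module A T] [AddCommGroup N] [Module A N] : Prop :=
  ∃ (k : ℕ) (i : N →ₗ[A] (Fin k → T)) (p : (Fin k → T) →ₗ[A] N), p ∘ₗ i = LinearMap.id

/-- `N` belongs to `gen^*(T)`: there is an exact sequence `⋯ → X 1 → X 0 → N → 0` (with maps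
`d i : X (i + 1) → X i` and `ε : X 0 → N`) whose terms `X i` lie in `add T`, and
`Ext^1(T, -)` vanishes on the kernels of all its maps. -/
def IsInGenStar (T N : Type u) [AddCommGroup T] [Module A T] [AddCommGroup N] [Module A N] :
    Prop :=
  ∃ (X : ℕ → ModuleCat.{u} A) (ε : X 0 →ₗ[A] N) (d : ∀ i, X (i + 1) →ₗ[A] X i),
    Function.Surjective ε ∧ Function.Exact (d 0) ε ∧ (∀ i, Function.Exact (d (i + 1)) (d i)) ∧
    (∀ i, IsInAdd A T (X i)) ∧
    ExtVanishes A T (LinearMap.ker ε) 1 ∧ ∀ i, ExtVanishes A T (LinearMap.ker (d i)) 1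

/-- The sequence `0 → A → X 0 → X 1 → ⋯` is exact and all `X i` lie in `add T`. -/
structure IsAddCoresolution (T : Type u) [AddCommGroup T] [Module A T]
    (X : ℕ → ModuleCat.{u} A) (η : A →ₗ[A] X 0) (d : ∀ i, X i →ₗ[A] X (i + 1)) : Prop where
  injective : Function.Injective η
  exact_zero : Function.Exact η (d 0)
  exact_succ : ∀ i, Function.Exact (d i) (d (i + 1))
  mem_add : ∀ i, IsInAdd A T (X i)

/-- The sequence `⋯ → Hom(X 1, T) → Hom(X 0, T) → Hom(A, T) → 0` obtained from
`0 → A → X 0 → X 1 → ⋯` by applying `Hom(-, T)` is exact. -/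
structure IsHomExact (T : Type u) [AddCommGroup T] [Module A T]
    (X : ℕ → ModuleCat.{u} A) (η : A →ₗ[A] X 0) (d : ∀ i, X i →ₗ[A] X (i + 1)) : Prop where
  surjective : Function.Surjective fun g : X 0 →ₗ[A] T => g ∘ₗ η
  exact_zero : Function.Exact (fun g : X 1 →ₗ[A] T => g ∘ₗ d 0) (fun g : X 0 →ₗ[A] T => g ∘ₗ η)
  exact_succ : ∀ i, Function.Exact (fun g : X (i + 2) →ₗ[A] T => g ∘ₗ d (i + 1))
    (fun g : X (i + 1) →ₗ[A] T => g ∘ₗ d i)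

/-- `T` is an `n`-tilting `A`-module (in the sense of Miyashita). The finite exact sequence
`0 → A → X 0 → ⋯ → X n → 0` is given as an infinite one whose terms after `X n` are zero. -/
structure IsNTilting (n : ℕ) (T : Type u) [AddCommGroup T] [Module A T] : Prop where
  genStar : IsInGenStar A A T
  pd_le : pd A T ≤ n
  ext_self : ∀ i : ℕ, 0 < i → ExtVanishes A T T i
  coresolution : ∃ (X : ℕ → ModuleCat.{u} A) (η : A →ₗ[A] X 0) (d : ∀ i, X i →ₗ[A] X (i + 1)),
    IsAddCoresolution A T X η d ∧ ∀ i, n < i → Subsingleton (X i)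

/-- `T` is a tilting `A`-module: it is `n`-tilting for some `n`. -/
def IsTilting (T : Type u) [AddCommGroup T] [Module A T] : Prop :=
  ∃ n : ℕ, IsNTilting A n T

/-- `T` is a Wakamatsu tilting `A`-module. -/
structure IsWakamatsuTilting (T : Type u) [AddCommGroup T] [Module A T] : Prop where
  genStar : IsInGenStar A A T
  ext_self : ∀ i : ℕ, 0 < i → ExtVanishes A T T i
  coresolution : ∃ (X : ℕ → ModuleCat.{u} A) (η : A →ₗ[A] X 0) (d : ∀ i, X i →ₗ[A] X (i + 1)),
    IsAddCoresolution A T X η d ∧ IsHomExact A T X η d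

end

/-- The `(S, R)`-bimodule `T` is a Wakamatsu tilting module: `T_R` is Wakamatsu tilting and
`End(T_R) = S`, i.e. the canonical ring homomorphism `S → End(T_R)`, sending `s` to `t ↦ s t`, is
bijective. -/
structure IsWakamatsuTiltingBimodule (S R : Type u) [Ring S] [Ring R]
    (T : Type u) [AddCommGroup T] [Module S T] [Module Rᵐᵒᵖ T] [SMulCommClass S Rᵐᵒᵖ T] :
    Prop where
  tilting : IsWakamatsuTilting Rᵐᵒᵖ T
  end_eq : Function.Bijective (Module.toModuleEnd Rᵐᵒᵖ (S := S) T)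

/-- The generalized Auslander–Reiten conjecture holds for the ring `A`: for every finitely
generated left `A`-module `M` and every `n ≥ 0`, if `Ext^i_A(M, M ⊕ A) = 0` for all `i > n`, then
`pd M ≤ n`. -/
def GARC (A : Type u) [Ring A] : Prop :=
  ∀ (M : Type u) [AddCommGroup M] [Module A M], Module.Finite A M →
    ∀ n : ℕ, (∀ i : ℕ, n < i → ExtVanishes A M (M × A) i) → pd A M ≤ n

/-- The Wakamatsu tilting conjecture holds for the ring `R`: every Wakamatsu tilting right
`R`-module of finite projective dimension is tilting. -/
def WTC (R : Type u) [Ring R] : Prop :=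
  ∀ (T : Type u) [AddCommGroup T] [Module Rᵐᵒᵖ T],
    IsWakamatsuTilting Rᵐᵒᵖ T → pd Rᵐᵒᵖ T < ⊤ → IsTilting Rᵐᵒᵖ T

end WakamatsuTilting

/-!
Write `B = Rᵐᵒᵖ`, so that `T` is a left `B`-module with `S = End_B(T)`, and let `n` bound its
projective dimension. Let `0 → B → X 0 → X 1 → ⋯` be a coresolution in `add T` that stays exact
under `Hom_B(-, T)`. On `add T` the functor `Hom_B(-, T)` takes values in finitely generated
projective `S`-modules and is fully faithful; more precisely, every `S`-linear map
`Hom_B(X, T) → Hom_B(Y, T)` with `X` in `add T` comes from a map `Y → X`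
(`IsInAdd.exists_lcomp_eq`, `IsInAdd.hom_ext`). Hence `⋯ → Hom_B(X 1, T) → Hom_B(X 0, T) → T → 0` is
a resolution of `T` by finitely generated projective `S`-modules, and applying `Hom_S(-, T × S)` to
it gives the complex `Hom_B(B × T, X 0) → Hom_B(B × T, X 1) → ⋯`. Its cohomology in degree `i > 0` is
`Ext^i_B(T, B)` by dimension shifting (`IsAddCoresolution.extVanishes_ker`), which is zero for
`i > n`; so `Ext^i_S(T, T × S) = 0` for `i > n`.

The generalized Auslander–Reiten conjecture for `S` now says that `T` has projective dimension at
most `n` over `S`. Then the image of `Hom_B(X (n + 1), T) → Hom_B(X n, T)`, a high syzygy of `T`, is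
projective. The resulting idempotent endomorphism of `Hom_B(X (n + 1), T)` comes from a projection
of `X (n + 1)` onto the image of `X n`, so this image lies in `add T`, and the coresolution of `B`
can be cut off there (`IsAddCoresolution.truncate`). This makes `T` an `(n + 1)`-tilting module.

The second statement is the case `S = End_B(T)` of the first.
-/

namespace WakamatsuTilting

/-! ### Vanishing of `Ext` along short exact sequences and on `add T` -/

section Ext

variable {A : Type u} [Ring A]
variable {K P M N T : Type u} [AddCommGroup K] [Module A K] [AddCommGroup P] [Module A P]
  [AddCommGroup M] [Module A M] [AddCommGroup N] [Module A N] [AddCommGroup T] [Module A T]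

theorem shortExact_of_exact {f : K →ₗ[A] P} {g : P →ₗ[A] M} (hf : Function.Injective f)
    (hfg : Function.Exact f g) (hg : Function.Surjective g) :
    (ShortComplex.mk (ModuleCat.ofHom f) (ModuleCat.ofHom g)
      (ModuleCat.hom_ext hfg.linearMap_comp_eq_zero)).ShortExact where
  exact := (ShortComplex.ShortExact.moduleCat_exact_iff_function_exact _).2 hfg
  mono_f := (ModuleCat.mono_iff_injective _).2 hf
  epi_g := (ModuleCat.epi_iff_surjective _).2 hg

theorem ExtVanishes.succ_of_projective {f : K →ₗ[A] P} {g : P →ₗ[A] M}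
    (hf : Function.Injective f) (hfg : Function.Exact f g) (hg : Function.Surjective g)
    [Module.Projective A P] {i : ℕ} (h : ExtVanishes A K N i) : ExtVanishes A M N (i + 1) := by
  have hS := shortExact_of_exact hf hfg hg
  have : Projective (ModuleCat.of A P) := (IsProjective.iff_projective P).1 inferInstance
  refine subsingleton_of_forall_eq 0 fun x => ?_
  obtain ⟨y, rfl⟩ := Ext.contravariant_sequence_exact₃ hS _ x
    (Ext.eq_zero_of_projective _) (add_comm 1 i)
  rw [@Subsingleton.elim _ h y 0, Ext.comp_zero]

theorem extVanishes_one_of_extend {f : K →ₗ[A] P} {g : P →ₗ[A] M}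
    (hf : Function.Injective f) (hfg : Function.Exact f g) (hg : Function.Surjective g)
    [Module.Projective A P] (h : ∀ φ : K →ₗ[A] N, ∃ ψ : P →ₗ[A] N, ψ ∘ₗ f = φ) :
    ExtVanishes A M N 1 := by
  have hS := shortExact_of_exact hf hfg hg
  have : Projective (ModuleCat.of A P) := (IsProjective.iff_projective P).1 inferInstance
  refine subsingleton_of_forall_eq 0 fun x => ?_
  obtain ⟨y, rfl⟩ := Ext.contravariant_sequence_exact₃ hS _ x
    (Ext.eq_zero_of_projective _) (add_comm 1 0)
  obtain ⟨φ, rfl⟩ := Ext.addEquiv₀.symm.surjective y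
  obtain ⟨ψ, hψ⟩ := h φ.hom
  have : φ = ModuleCat.ofHom f ≫ ModuleCat.ofHom ψ := ModuleCat.hom_ext hψ.symm
  rw [this, Ext.addEquiv₀_symm_apply, ← Ext.mk₀_comp_mk₀]
  exact hS.extClass_comp_assoc _

theorem ExtVanishes.of_shortExact {f : K →ₗ[A] P} {g : P →ₗ[A] M}
    (hf : Function.Injective f) (hfg : Function.Exact f g) (hg : Function.Surjective g)
    {i : ℕ} (hK : ExtVanishes A T K (i + 1)) (hP : ExtVanishes A T P i) :
    ExtVanishes A T M i := by
  have hS := shortExact_of_exact hf hfg hg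
  refine subsingleton_of_forall_eq 0 fun x => ?_
  obtain ⟨y, rfl⟩ := Ext.covariant_sequence_exact₃ _ hS x rfl (@Subsingleton.elim _ hK _ _)
  rw [@Subsingleton.elim _ hP y 0, Ext.zero_comp]

theorem ExtVanishes.exists_lift {f : K →ₗ[A] P} {g : P →ₗ[A] M}
    (hf : Function.Injective f) (hfg : Function.Exact f g) (hg : Function.Surjective g)
    (hK : ExtVanishes A T K 1) (φ : T →ₗ[A] M) : ∃ ψ : T →ₗ[A] P, g ∘ₗ ψ = φ := by
  have hS := shortExact_of_exact hf hfg hg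
  obtain ⟨y, hy⟩ := Ext.covariant_sequence_exact₃ _ hS (Ext.mk₀ (ModuleCat.ofHom φ)) rfl
    (@Subsingleton.elim _ hK _ _)
  obtain ⟨ψ, rfl⟩ := Ext.addEquiv₀.symm.surjective y
  rw [Ext.addEquiv₀_symm_apply, Ext.mk₀_comp_mk₀] at hy
  have := (Ext.mk₀_bijective _ _).1 hy
  exact ⟨ψ.hom, congrArg ModuleCat.Hom.hom this⟩

theorem IsInAdd.of_linearEquiv (e : N ≃ₗ[A] T) : IsInAdd A T N :=
  ⟨1, LinearMap.pi fun _ => e.toLinearMap, e.symm.toLinearMap ∘ₗ LinearMap.proj 0, by ext; simp⟩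

theorem IsInAdd.of_retract (h : IsInAdd A T P) (i : N →ₗ[A] P) (p : P →ₗ[A] N)
    (hpi : p ∘ₗ i = LinearMap.id) : IsInAdd A T N := by
  obtain ⟨k, j, q, hqj⟩ := h
  refine ⟨k, j ∘ₗ i, p ∘ₗ q, ?_⟩
  rw [LinearMap.comp_assoc, ← LinearMap.comp_assoc i j q, hqj, LinearMap.id_comp, hpi]

theorem IsInAdd.of_subsingleton [Subsingleton N] : IsInAdd A T N :=
  ⟨0, 0, 0, LinearMap.ext fun _ => Subsingleton.elim _ _⟩

/-- `Ext^i(M, -)` is additive, so its vanishing passes from `T` to the modules in `add T`. -/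
theorem ExtVanishes.of_isInAdd {i : ℕ} (hT : ExtVanishes A M T i) (h : IsInAdd A T N) :
    ExtVanishes A M N i := by
  obtain ⟨k, j, p, hpj⟩ := h
  have hid : 𝟙 (ModuleCat.of A N) = ∑ l : Fin k,
      ModuleCat.ofHom (LinearMap.proj l ∘ₗ j) ≫
        ModuleCat.ofHom (p ∘ₗ LinearMap.single A (fun _ => T) l) := by
    ext x
    have := LinearMap.congr_fun hpj x
    simp only [LinearMap.comp_apply, LinearMap.id_apply] at this
    simp only [ModuleCat.hom_sum, LinearMap.sum_apply]
    simp [← map_sum, LinearMap.sum_single_apply, this]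
  refine subsingleton_of_forall_eq 0 fun x => ?_
  rw [← x.comp_mk₀_id, hid, Ext.mk₀_sum, Ext.comp_sum]
  refine Finset.sum_eq_zero fun l _ => ?_
  rw [← Ext.mk₀_comp_mk₀, ← Ext.comp_assoc_of_third_deg_zero, @Subsingleton.elim _ hT (x.comp _ _) 0,
    Ext.zero_comp]

end Ext

/-! ### Projective resolutions -/

section Resolution

variable {A : Type u} [Ring A]

/-- `Ext` is computed by a projective resolution: `Ext^{i+1}(M, N)` vanishes if every cocycle
`P (i + 1) → N` is a coboundary. -/
theorem extVanishes_of_resolution (N : Type u) [AddCommGroup N] [Module A N] (i : ℕ) :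
    ∀ (M : Type u) [AddCommGroup M] [Module A M] (P : ℕ → Type u) [∀ j, AddCommGroup (P j)]
      [∀ j, Module A (P j)] [∀ j, Module.Projective A (P j)] (ε : P 0 →ₗ[A] M)
      (δ : ∀ j, P (j + 1) →ₗ[A] P j), Function.Surjective ε → Function.Exact (δ 0) ε →
      (∀ j, Function.Exact (δ (j + 1)) (δ j)) →
      (∀ φ : P (i + 1) →ₗ[A] N, φ ∘ₗ δ (i + 1) = 0 → ∃ ψ : P i →ₗ[A] N, ψ ∘ₗ δ i = φ) →
      ExtVanishes A M N (i + 1) := by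
  induction i with
  | zero =>
    intro M _ _ P _ _ _ ε δ hε h0 hδ H
    refine extVanishes_one_of_extend (LinearMap.range (δ 0)).injective_subtype
      (LinearMap.exact_iff.2 (by rw [Submodule.range_subtype, h0.linearMap_ker_eq])) hε
      fun φ => ?_
    obtain ⟨ψ, hψ⟩ := H (φ ∘ₗ (δ 0).rangeRestrict) (by
      ext x
      have : (δ 0).rangeRestrict (δ (0 + 1) x) = 0 := Subtype.ext ((hδ 0).apply_apply_eq_zero x)
      simp [this])
    refine ⟨ψ, LinearMap.ext ?_⟩
    rintro ⟨_, x, rfl⟩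
    exact LinearMap.congr_fun hψ x
  | succ i ih =>
    intro M _ _ P _ _ _ ε δ hε h0 hδ H
    refine ExtVanishes.succ_of_projective (LinearMap.range (δ 0)).injective_subtype
      (LinearMap.exact_iff.2 (by rw [Submodule.range_subtype, h0.linearMap_ker_eq])) hε ?_
    refine ih _ (fun j => P (j + 1)) (δ 0).rangeRestrict (fun j => δ (j + 1))
      (δ 0).surjective_rangeRestrict ?_ (fun j => hδ (j + 1)) H
    rw [LinearMap.exact_iff, LinearMap.ker_rangeRestrict, (hδ 0).linearMap_ker_eq]

/-- In a projective resolution of a module of projective dimension at most `i + 1`, the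
`(i + 1)`-st syzygy, which is the range of `P (i + 1) → P i`, is projective. -/
theorem projective_range_of_resolution (i : ℕ) :
    ∀ (M : Type u) [AddCommGroup M] [Module A M] (P : ℕ → Type u) [∀ j, AddCommGroup (P j)]
      [∀ j, Module A (P j)] [∀ j, Module.Projective A (P j)] (ε : P 0 →ₗ[A] M)
      (δ : ∀ j, P (j + 1) →ₗ[A] P j), Function.Surjective ε → Function.Exact (δ 0) ε →
      (∀ j, Function.Exact (δ (j + 1)) (δ j)) →
      HasProjectiveDimensionLT (ModuleCat.of A M) (i + 2) →
      Module.Projective A (LinearMap.range (δ i)) := by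
  -- Passing to the first syzygy lowers a positive bound on the projective dimension by one.
  have key : ∀ (i : ℕ) (M : Type u) [AddCommGroup M] [Module A M] (P₀ P₁ : Type u)
      [AddCommGroup P₀] [Module A P₀] [Module.Projective A P₀] [AddCommGroup P₁] [Module A P₁]
      (ε : P₀ →ₗ[A] M) (δ : P₁ →ₗ[A] P₀), Function.Surjective ε → Function.Exact δ ε →
      HasProjectiveDimensionLT (ModuleCat.of A M) (i + 2) →
      HasProjectiveDimensionLT (ModuleCat.of A (LinearMap.range δ)) (i + 1) := by
    intro i M _ _ P₀ P₁ _ _ _ _ _ ε δ hε h0 hM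
    have hS := shortExact_of_exact (LinearMap.range δ).injective_subtype
      (LinearMap.exact_iff.2 (by rw [Submodule.range_subtype, h0.linearMap_ker_eq])) hε
    exact (hS.hasProjectiveDimensionLT_X₃_iff i
      ((IsProjective.iff_projective P₀).1 inferInstance)).1 hM
  induction i with
  | zero =>
    intro M _ _ P _ _ _ ε δ hε h0 hδ hM
    have := key 0 M _ _ ε (δ 0) hε h0 hM
    exact (IsProjective.iff_projective _ ).2 (projective_iff_hasProjectiveDimensionLT_one.2 this)
  | succ i ih =>
    intro M _ _ P _ _ _ ε δ hε h0 hδ hM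
    refine ih _ (fun j => P (j + 1)) (δ 0).rangeRestrict (fun j => δ (j + 1))
      (δ 0).surjective_rangeRestrict ?_ (fun j => hδ (j + 1))
      (key (i + 1) M _ _ ε (δ 0) hε h0 hM)
    rw [LinearMap.exact_iff, LinearMap.ker_rangeRestrict, (hδ 0).linearMap_ker_eq]

end Resolution

/-! ### The functor `Hom_B(-, T)` on `add T` -/

section Duality

variable {S B : Type u} [Ring S] [Ring B] {T : Type u} [AddCommGroup T] [Module S T] [Module B T]
  [SMulCommClass B S T]
variable {X Y : Type u} [AddCommGroup X] [Module B X] [AddCommGroup Y] [Module B Y]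

/-- Modules in `add T` are cogenerated by `T`. -/
theorem IsInAdd.hom_ext (hX : IsInAdd B T X) {f g : Y →ₗ[B] X}
    (h : ∀ q : X →ₗ[B] T, q ∘ₗ f = q ∘ₗ g) : f = g := by
  obtain ⟨k, i, p, hpi⟩ := hX
  have : i ∘ₗ f = i ∘ₗ g := by
    refine LinearMap.ext fun y => funext fun l => ?_
    exact LinearMap.congr_fun (h (LinearMap.proj l ∘ₗ i)) y
  rw [← LinearMap.id_comp f, ← LinearMap.id_comp g, ← hpi, LinearMap.comp_assoc, this,
    LinearMap.comp_assoc]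

/-- If `S → End_B(T)` is surjective and `X` lies in `add T`, then each `S`-linear map
`Hom_B(X, T) → Hom_B(Y, T)` is composition with a `B`-linear map `Y → X`. This is clear for
`X = T`, and both sides are additive in `X`. -/
theorem IsInAdd.exists_lcomp_eq (hS : ∀ h : T →ₗ[B] T, ∃ s : S, ∀ t, h t = s • t)
    (hX : IsInAdd B T X) (φ : (X →ₗ[B] T) →ₗ[S] (Y →ₗ[B] T)) :
    ∃ f : Y →ₗ[B] X, φ = LinearMap.lcomp S T f := by
  obtain ⟨k, i, p, hpi⟩ := hX
  refine ⟨p ∘ₗ LinearMap.pi fun l => φ (LinearMap.proj l ∘ₗ i), LinearMap.ext fun q => ?_⟩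
  choose s hs using fun l => hS (q ∘ₗ p ∘ₗ LinearMap.single B (fun _ => T) l)
  have hsum : ∀ v : Fin k → T, q (p v) = ∑ l, s l • v l := by
    intro v
    have hv : ∑ l, LinearMap.single B (fun _ => T) l (v l) = v := by
      ext l
      simp [Finset.sum_apply, Pi.single_apply]
    simp only [← hs, LinearMap.comp_apply, ← map_sum, hv]
  have hq : q = ∑ l, s l • (LinearMap.proj l ∘ₗ i : X →ₗ[B] T) := by
    ext x
    have := hsum (i x)
    rw [show p (i x) = x from LinearMap.congr_fun hpi x] at this
    simpa [LinearMap.sum_apply] using this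
  ext y
  conv_lhs => rw [hq, map_sum]
  simp [LinearMap.sum_apply, hsum]

/-- The `S`-linear isomorphism `S ≅ Hom_B(T, T)`, `s ↦ (t ↦ s t)`. The hypotheses say that the
canonical ring homomorphism `S → End_B(T)` is surjective and injective. -/
noncomputable def ringEquivHom (hS : ∀ h : T →ₗ[B] T, ∃ s : S, ∀ t, h t = s • t)
    (hS' : ∀ s : S, (∀ t : T, s • t = 0) → s = 0) : S ≃ₗ[S] (T →ₗ[B] T) :=
  LinearEquiv.ofBijective (LinearMap.toSpanSingleton S (T →ₗ[B] T) LinearMap.id)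
    ⟨(injective_iff_map_eq_zero _).2 fun s hs => hS' s fun t => by
        simpa using LinearMap.congr_fun hs t,
      fun h => (hS h).imp fun s hs => LinearMap.ext fun t => by simp [hs]⟩

/-- `Hom_B(-, T)` sends `add T` to finitely generated projective `S`-modules. -/
theorem IsInAdd.projective_finite_hom (hS : ∀ h : T →ₗ[B] T, ∃ s : S, ∀ t, h t = s • t)
    (hS' : ∀ s : S, (∀ t : T, s • t = 0) → s = 0) (hX : IsInAdd B T X) :
    Module.Projective S (X →ₗ[B] T) ∧ Module.Finite S (X →ₗ[B] T) := by
  obtain ⟨k, i, p, hpi⟩ := hX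
  let e : (Fin k → S) ≃ₗ[S] ((Fin k → T) →ₗ[B] T) :=
    (LinearEquiv.piCongrRight fun _ => ringEquivHom hS hS').trans
      (LinearMap.lsum B (fun _ : Fin k => T) S)
  have hid : LinearMap.lcomp S T i ∘ₗ LinearMap.lcomp S T p = LinearMap.id := by
    refine LinearMap.ext fun q => ?_
    change (q ∘ₗ p) ∘ₗ i = q
    rw [LinearMap.comp_assoc, hpi, LinearMap.comp_id]
  have := Module.Projective.of_equiv e
  have := Module.Finite.equiv e
  exact ⟨Module.Projective.of_split _ _ hid,
    Module.Finite.of_surjective (LinearMap.lcomp S T i) fun q => ⟨_, LinearMap.congr_fun hid q⟩⟩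

end Duality

/-! ### Coresolutions by modules in `add T` -/

section Syzygies

variable {B : Type u} [Ring B] {T : Type u} [AddCommGroup T] [Module B T]

theorem exact_codRestrict_ker {P Q N : Type u} [AddCommGroup P] [Module B P] [AddCommGroup Q]
    [Module B Q] [AddCommGroup N] [Module B N] {f : P →ₗ[B] Q} {g : Q →ₗ[B] N}
    (h : Function.Exact f g) :
    Function.Exact (LinearMap.ker f).subtype
        (f.codRestrict (LinearMap.ker g) h.apply_apply_eq_zero) ∧
      Function.Surjective (f.codRestrict (LinearMap.ker g) h.apply_apply_eq_zero) := by
  refine ⟨LinearMap.exact_iff.2 ((LinearMap.ker_codRestrict _ _ _).trans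
    (Submodule.range_subtype _).symm), ?_⟩
  rintro ⟨y, hy⟩
  obtain ⟨x, rfl⟩ := (h y).1 hy
  exact ⟨x, rfl⟩

variable {X : ℕ → ModuleCat.{u} B} {η : B →ₗ[B] X 0} {d : ∀ i, X i →ₗ[B] X (i + 1)}

/-- Dimension shifting along `0 → B → X 0 → X 1 → ⋯`: the group `Ext^j(T, ker (d i))` is
`Ext^{i+j}(T, B)`, because `T` is `Ext`-orthogonal to `add T`. -/
theorem IsAddCoresolution.extVanishes_ker (hX : IsAddCoresolution B T X η d)
    (hT : ∀ i : ℕ, 0 < i → ExtVanishes B T T i) {n : ℕ}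
    (hB : ∀ i : ℕ, n < i → ExtVanishes B T B i) (i : ℕ) :
    ∀ j : ℕ, 0 < j → n < i + j → ExtVanishes B T (LinearMap.ker (d i)) j := by
  induction i with
  | zero =>
    intro j _ hj
    refine (hB j (by omega)).of_isInAdd (IsInAdd.of_linearEquiv ?_)
    exact (LinearEquiv.ofEq _ _ hX.exact_zero.linearMap_ker_eq).trans
      (LinearEquiv.ofInjective η hX.injective).symm
  | succ i ih =>
    intro j hj hij
    obtain ⟨hexact, hsurj⟩ := exact_codRestrict_ker (hX.exact_succ i)
    exact ExtVanishes.of_shortExact (LinearMap.ker (d i)).injective_subtype hexact hsurj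
      (ih (j + 1) (by omega) (by omega)) ((hT j hj).of_isInAdd (hX.mem_add i))

/-- Above the degree `n` past which `Ext(T, B)` vanishes, the complex
`Hom(T, X 0) → Hom(T, X 1) → ⋯` is exact. -/
theorem IsAddCoresolution.exists_lift (hX : IsAddCoresolution B T X η d)
    (hT : ∀ i : ℕ, 0 < i → ExtVanishes B T T i) {n : ℕ}
    (hB : ∀ i : ℕ, n < i → ExtVanishes B T B i) {i : ℕ} (hi : n ≤ i) (f : T →ₗ[B] X (i + 1))
    (hf : d (i + 1) ∘ₗ f = 0) : ∃ g : T →ₗ[B] X i, d i ∘ₗ g = f := by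
  obtain ⟨hexact, hsurj⟩ := exact_codRestrict_ker (hX.exact_succ i)
  obtain ⟨ψ, hψ⟩ := ExtVanishes.exists_lift (LinearMap.ker (d i)).injective_subtype hexact hsurj
    (hX.extVanishes_ker hT hB i 1 one_pos (by omega))
    (f.codRestrict (LinearMap.ker (d (i + 1))) fun t => LinearMap.congr_fun hf t)
  exact ⟨ψ, LinearMap.ext fun t => congrArg Subtype.val (LinearMap.congr_fun hψ t)⟩

/-- Truncation of a coresolution: if `ker (d (n + 1))`, which is the image of `X n → X (n + 1)`,
lies in `add T`, then `0 → B → X 0 → ⋯ → X n → ker (d (n + 1)) → 0` is an exact sequence with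
terms in `add T`. -/
theorem IsAddCoresolution.truncate (hX : IsAddCoresolution B T X η d) (n : ℕ)
    (hn : IsInAdd B T (LinearMap.ker (d (n + 1)))) :
    ∃ (X' : ℕ → ModuleCat.{u} B) (η' : B →ₗ[B] X' 0) (d' : ∀ i, X' i →ₗ[B] X' (i + 1)),
      IsAddCoresolution B T X' η' d' ∧ ∀ i, n + 1 < i → Subsingleton (X' i) := by
  -- The terms of the truncation are submodules `W i` of `X i`, so that `d` restricts to them.
  let W : ∀ i, Submodule B (X i) := fun i =>
    if i ≤ n then ⊤ else if i = n + 1 then LinearMap.ker (d i) else ⊥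
  have hW₁ : ∀ i, i ≤ n → W i = ⊤ := fun i hi => if_pos hi
  have hW₂ : W (n + 1) = LinearMap.ker (d (n + 1)) := by simp [W]
  have hW₃ : ∀ i, n + 1 < i → W i = ⊥ := fun i hi => by
    simp only [W]; rw [if_neg (by omega), if_neg (by omega)]
  have hdd : ∀ i x, d (i + 1) (d i x) = 0 := fun i => (hX.exact_succ i).apply_apply_eq_zero
  have hd : ∀ i, ∀ x ∈ W i, d i x ∈ W (i + 1) := by
    intro i x hx
    rcases lt_trichotomy i n with h | rfl | h
    · rw [hW₁ _ h]; trivial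
    · rw [hW₂]; exact hdd i x
    · have : d i x = 0 := by
        rcases (show n + 1 ≤ i from h).eq_or_lt with rfl | h'
        · rwa [hW₂] at hx
        · rw [hW₃ i h', Submodule.mem_bot] at hx
          rw [hx, map_zero]
      rw [this]; exact zero_mem _
  have hη : ∀ b, η b ∈ W 0 := fun b => by rw [hW₁ 0 n.zero_le]; trivial
  -- An element of `W (i + 1)` killed by `d` comes from `W i`.
  have hex : ∀ i, ∀ y ∈ W (i + 1), d (i + 1) y = 0 → ∃ x ∈ W i, d i x = y := by
    intro i y hy hy'
    rcases le_or_gt i n with h | h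
    · obtain ⟨x, rfl⟩ := (hX.exact_succ i y).1 hy'
      exact ⟨x, by rw [hW₁ i h]; trivial, rfl⟩
    · rw [hW₃ (i + 1) (by omega), Submodule.mem_bot] at hy
      exact ⟨0, zero_mem _, by rw [hy, map_zero]⟩
  refine ⟨fun i => ModuleCat.of B (W i), η.codRestrict (W 0) hη,
    fun i => (d i).restrict (hd i), ⟨?_, ?_, ?_, ?_⟩, ?_⟩
  · intro a b hab
    exact hX.injective (congrArg Subtype.val hab)
  · rintro ⟨x, hx⟩
    refine ⟨fun h => ?_, ?_⟩
    · obtain ⟨b, rfl⟩ := (hX.exact_zero x).1 (congrArg Subtype.val h)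
      exact ⟨b, rfl⟩
    · rintro ⟨b, hb⟩
      obtain rfl : η b = x := congrArg Subtype.val hb
      exact Subtype.ext (hX.exact_zero.apply_apply_eq_zero b)
  · rintro i ⟨y, hy⟩
    refine ⟨fun h => ?_, ?_⟩
    · obtain ⟨x, hx, rfl⟩ := hex i y hy (congrArg Subtype.val h)
      exact ⟨⟨x, hx⟩, rfl⟩
    · rintro ⟨⟨x, hx⟩, hxy⟩
      obtain rfl : d i x = y := congrArg Subtype.val hxy
      exact Subtype.ext (hdd i x)
  · intro i
    change IsInAdd B T (W i)
    rcases lt_trichotomy i (n + 1) with h | rfl | h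
    · rw [hW₁ i (by omega)]
      exact (hX.mem_add i).of_retract Submodule.topEquiv.toLinearMap
        Submodule.topEquiv.symm.toLinearMap (LinearMap.ext fun _ => rfl)
    · rwa [hW₂]
    · rw [hW₃ i h]
      exact IsInAdd.of_subsingleton
  · intro i hi
    change Subsingleton (W i)
    rw [hW₃ i hi]
    infer_instance

end Syzygies

/-! ### Wakamatsu tilting modules over rings satisfying the conjecture -/

section Main

variable {S B : Type u} [Ring S] [Ring B] {T : Type u} [AddCommGroup T] [Module S T] [Module B T]
  [SMulCommClass B S T]

/-- A Wakamatsu tilting left `B`-module of finite projective dimension is tilting if the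
generalized Auslander–Reiten conjecture holds for its endomorphism ring `S`. The identification of
`S` with `End_B(T)` is given elementwise by `hS` and `hS'`. -/
theorem IsWakamatsuTilting.isTilting_of_garc (hS : ∀ h : T →ₗ[B] T, ∃ s : S, ∀ t, h t = s • t)
    (hS' : ∀ s : S, (∀ t : T, s • t = 0) → s = 0) (hT : IsWakamatsuTilting B T)
    (hpd : pd B T < ⊤) (hG : GARC S) : IsTilting B T := by
  obtain ⟨X, η, d, hX, hH⟩ := hT.coresolution
  obtain ⟨n, hn⟩ := (projectiveDimension_ne_top_iff _).1 hpd.ne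
  have hB : ∀ i : ℕ, n < i → ExtVanishes B T B i := fun i hi =>
    HasProjectiveDimensionLT.subsingleton _ (n + 1) i hi _
  -- `Hom_B(-, T)` turns the coresolution of `B` into a projective resolution of `T` over `S`.
  let P : ℕ → Type u := fun i => X i →ₗ[B] T
  let δ : ∀ i, P (i + 1) →ₗ[S] P i := fun i => LinearMap.lcomp S T (d i)
  let e : (B →ₗ[B] T) ≃ₗ[S] T := LinearMap.ringLmapEquivSelf B S T
  let ε : P 0 →ₗ[S] T := e.toLinearMap ∘ₗ LinearMap.lcomp S T η
  have hproj : ∀ i, Module.Projective S (P i) := fun i =>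
    ((hX.mem_add i).projective_finite_hom hS hS').1
  have hε : Function.Surjective ε := e.surjective.comp hH.surjective
  have h0 : Function.Exact (δ 0) ε := fun g =>
    (e.map_eq_zero_iff (x := LinearMap.lcomp S T η g)).trans (hH.exact_zero g)
  have hδ : ∀ i, Function.Exact (δ (i + 1)) (δ i) := hH.exact_succ
  have hfin : Module.Finite S T :=
    have := ((hX.mem_add 0).projective_finite_hom hS hS').2
    Module.Finite.of_surjective ε hε
  -- `T × S ≅ Hom_B(B × T, T)`, so that cochains with values in `T × S` are maps `B × T → X i`.
  let E : (T × S) ≃ₗ[S] (B × T →ₗ[B] T) :=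
    (e.symm.prodCongr (ringEquivHom hS hS')).trans (LinearMap.coprodEquiv S)
  have hExt : ∀ i : ℕ, n < i → ExtVanishes S T (T × S) i := by
    intro i hi
    obtain ⟨i, rfl⟩ := Nat.exists_eq_succ_of_ne_zero (Nat.ne_zero_of_lt hi)
    refine extVanishes_of_resolution (T × S) i T P ε δ hε h0 hδ fun φ hφ => ?_
    obtain ⟨f, hf⟩ := (hX.mem_add (i + 1)).exists_lcomp_eq hS (E.toLinearMap ∘ₗ φ)
    have hdf : d (i + 1) ∘ₗ f = 0 := (hX.mem_add (i + 2)).hom_ext fun q => by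
      have h1 := LinearMap.congr_fun hf (q ∘ₗ d (i + 1))
      have h2 : φ (q ∘ₗ d (i + 1)) = 0 := LinearMap.congr_fun hφ q
      rw [LinearMap.comp_apply, h2, map_zero] at h1
      rw [← LinearMap.comp_assoc, LinearMap.comp_zero]
      exact h1.symm
    obtain ⟨g₂, hg₂⟩ := hX.exists_lift hT.ext_self hB (Nat.lt_succ_iff.1 hi)
      (f ∘ₗ LinearMap.inr B B T) (by rw [← LinearMap.comp_assoc, hdf, LinearMap.zero_comp])
    -- On the factor `T` the map `f` lifts by the vanishing of `Ext`, on `B` because `B` is free.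
    obtain ⟨x, hx⟩ := (hX.exact_succ i (f (1, 0))).1 (LinearMap.congr_fun hdf (1, 0))
    let g : B × T →ₗ[B] X i := (LinearMap.toSpanSingleton B (X i) x).coprod g₂
    have hg : d i ∘ₗ g = f := by
      refine LinearMap.prod_ext (LinearMap.ext_ring ?_) ?_
      · simp [g, hx]
      · rw [← hg₂, LinearMap.comp_assoc, LinearMap.coprod_inr]
    refine ⟨E.symm.toLinearMap ∘ₗ LinearMap.lcomp S T g, LinearMap.ext fun q => ?_⟩
    refine E.injective ?_
    have h1 : E (φ q) = q ∘ₗ f := LinearMap.congr_fun hf q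
    rw [h1, ← hg]
    exact E.apply_symm_apply _
  have hle := hG T hfin n hExt
  -- The bound `n + 1` in place of `n` makes the projective syzygy the range of `P (n + 1) → P n`,
  -- also when `n = 0`.
  have hlt : HasProjectiveDimensionLT (ModuleCat.of S T) (n + 2) :=
    have : HasProjectiveDimensionLT (ModuleCat.of S T) (n + 1) :=
      (projectiveDimension_le_iff _ n).1 hle
    hasProjectiveDimensionLT_of_ge _ (n + 1) (n + 2) (by omega)
  have := projective_range_of_resolution n T P ε δ hε h0 hδ hlt
  -- The splitting of `P (n + 1) → range (δ n)` yields an idempotent endomorphism of `P (n + 1)`,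
  -- which is induced by a projection `f` of `X (n + 1)` onto `ker (d (n + 1))`.
  obtain ⟨σ, hσ⟩ := Module.projective_lifting_property (δ n).rangeRestrict LinearMap.id
    (δ n).surjective_rangeRestrict
  obtain ⟨f, hf⟩ := (hX.mem_add (n + 1)).exists_lcomp_eq hS (σ ∘ₗ (δ n).rangeRestrict)
  have hfd : f ∘ₗ d n = d n := (hX.mem_add (n + 1)).hom_ext fun q => by
    have h1 : σ ((δ n).rangeRestrict q) = q ∘ₗ f := LinearMap.congr_fun hf q
    have h2 := congrArg Subtype.val (LinearMap.congr_fun hσ ((δ n).rangeRestrict q))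
    rw [LinearMap.comp_apply, h1] at h2
    exact h2
  have hdf : ∀ x, d (n + 1) (f x) = 0 := by
    refine LinearMap.congr_fun (f := d (n + 1) ∘ₗ f) (g := 0) ?_
    refine (hX.mem_add (n + 2)).hom_ext fun q => ?_
    have h1 : σ ((δ n).rangeRestrict (δ (n + 1) q)) = (q ∘ₗ d (n + 1)) ∘ₗ f :=
      LinearMap.congr_fun hf (δ (n + 1) q)
    have h2 : (δ n).rangeRestrict (δ (n + 1) q) = 0 :=
      Subtype.ext ((hδ n).apply_apply_eq_zero q)
    rw [h2, map_zero] at h1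
    rw [← LinearMap.comp_assoc, ← h1, LinearMap.comp_zero]
  have hker : IsInAdd B T (LinearMap.ker (d (n + 1))) :=
    (hX.mem_add (n + 1)).of_retract (LinearMap.ker (d (n + 1))).subtype
      (f.codRestrict _ hdf) <| LinearMap.ext <| by
        rintro ⟨y, hy⟩
        obtain ⟨x, rfl⟩ := (hX.exact_succ n y).1 hy
        exact Subtype.ext (LinearMap.congr_fun hfd x)
  refine ⟨n + 1, hT.genStar, ?_, hT.ext_self, hX.truncate n hker⟩
  refine ((projectiveDimension_le_iff _ n).2 hn).trans ?_
  exact_mod_cast n.le_succ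

end Main

end WakamatsuTilting

theorem theorem1p3 :
    (∀ (S R : Type u) [Ring S] [Ring R] (T : Type u) [AddCommGroup T] [Module S T]
      [Module Rᵐᵒᵖ T] [SMulCommClass S Rᵐᵒᵖ T],
      WakamatsuTilting.IsWakamatsuTiltingBimodule S R T →
      WakamatsuTilting.pd Rᵐᵒᵖ T < ⊤ →
      WakamatsuTilting.GARC S →
      WakamatsuTilting.IsTilting Rᵐᵒᵖ T) ∧
    ((∀ (A : Type u) [Ring A], WakamatsuTilting.GARC A) →
      ∀ (R : Type u) [Ring R], WakamatsuTilting.WTC R) := by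
  refine ⟨fun S R _ _ T _ _ _ _ hT hpd hG => ?_, fun hG R _ T _ _ hT hpd => ?_⟩
  · have : SMulCommClass Rᵐᵒᵖ S T := SMulCommClass.symm S Rᵐᵒᵖ T
    refine hT.tilting.isTilting_of_garc (S := S) (fun h => ?_) (fun s hs => ?_) hpd hG
    · obtain ⟨s, rfl⟩ := hT.end_eq.2 h
      exact ⟨s, fun t => rfl⟩
    · refine (injective_iff_map_eq_zero (Module.toModuleEnd Rᵐᵒᵖ (S := S) T)).1 hT.end_eq.1 s ?_
      exact LinearMap.ext hs
  · exact hT.isTilting_of_garc (S := Module.End Rᵐᵒᵖ T) (fun h => ⟨h, fun t => rfl⟩)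
      (fun s hs => LinearMap.ext hs) hpd (hG _)
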